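/- **Market.** There are $N$ firms $p_1,\dots,p_N$ and $M$ types of workers, with $K_m$ workers $a^m_1,\dots,a^m_{K_m}$ of type $m$; put $K=\sum_m K_m$ and $K_{\max}=\max_m K_m$. Firm $p_i$ has a minimum quota $q_i^m$ for each type $m$ and a total quota $Q_i\ge\sum_m q_i^m$, with at least one position per type in total, $Q_i\ge M$; put $Q=\sum_i Q_i$. Every worker has a known strict ranking of the firms. **Double matching.** Given scores $x=(x^m_{i,j})$, each firm ranks workers by decreasing score (equal scores are ranked in a fixed order). First, for every type $m$ separately, firm-proposing deferred acceptance is run with the quotas $q_i^m$. Then firm-proposing deferred acceptance without type consideration is run on all workers who are still free, with the left-over quotas $Q_i-\sum_m q_i^m$. Let $u_i^m(x)$ be the set of type-$m$ workers whom $p_i$ obtains in the two runs together. **Rewards.** The true scores $\mu=(\mu^m_{i,j})$ are drawn from a prior distribution on $[0,1]^{NK}$. Whenever $p_i$ and $a^m_j$ are matched, a reward $y=\mu^m_{i,j}+\epsilon$ is observed. Given $\mu$, the rewards are independent over matched pairs and rounds, the law of the reward of a pair depends only on the pair and its true score, and $\epsilon$ is sub-Gaussian with a parameter $\sigma$ satisfying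 $\sigma^2\le 1/2$, i.e. $\mathbb E[e^{\alpha\epsilon}]\le e^{\alpha^2\sigma^2/2}$ for all $\alpha\in\mathbb R$ (for example, Bernoulli rewards). **MMTS** (Thompson sampling with double matching). In each round $t=1,\dots,T$, draw $\widehat\mu(t)$ from the posterior distribution of $\mu$ given the matchings and rewards of the rounds before $t$, match by $u_{i,t}^m=u_i^m(\widehat\mu(t))$, and observe the rewards of the matched pairs. **Regret.** Let $\overline u_i^m=u_i^m(\mu)$ be the matching that double matching produces from the true scores (the firm-optimal benchmark). The Bayesian social welfare gap is $$\mathfrak R(T)=\mathbb E_\mu\Big[\sum_{i=1}^N\sum_{m=1}^M R_i^m(T,\mu)\Big],\qquad R_i^m(T,\mu)=\mathbb E\Big[\sum_{t=1}^T\Big(\sum_{a^m_j\in\overline u_i^m}\mu^m_{i,j}-\sum_{a^m_j\in u_{i,t}^m}\mu^m_{i,j}\Big)\,\Big|\,\mu\Big].$$ **Theorem.** When all firms follow MMTS, for every horizon $T$, $$\mathfrak R(T)\le 8\,Q\log(QT)\sqrt{K_{\max}T}+\frac{NK}{Q}$$ (with $\log 0$ and $x/0$ read as $0$ in the degenerate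 cases $T=0$ or $Q=0$). -/

import Mathlib

open MeasureTheory ProbabilityTheory
open scoped NNReal

namespace CMCPR

/-! ### Rankings and firm-proposing deferred acceptance with quotas -/

section DeferredAcceptance

variable {N : ℕ} {W : Type} [Fintype W] [LinearOrder W]

open Classical in
/-- Rank (`0` is best) of `a` within the set `S` of workers when they are sorted by the score `x`
in descending order. Equal scores are ranked by the fixed order of `W`, so there are no ties. -/
noncomputable def scoreRank (S : Finset W) (x : W → ℝ) (a : W) : ℕ :=
  (S.filter fun b => x a < x b ∨ (x b = x a ∧ b < a)).card

/-- State of the deferred-acceptance loop: the pairs (firm, worker) for which the firm has already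
contacted the worker, and the firm that currently holds each worker (`none` if she is free). -/
structure DAState (N : ℕ) (W : Type) where
  contacted : Finset (Fin N × W)
  partner : W → Option (Fin N)

/-- The workers currently matched with firm `i`. -/
def DAState.held (s : DAState N W) (i : Fin N) : Finset W :=
  Finset.univ.filter fun a => s.partner a = some i

/-- The workers of the pool whom firm `i` has not yet contacted. -/
def DAState.uncontacted (s : DAState N W) (pool : Finset W) (i : Fin N) : Finset W :=
  pool.filter fun a => (i, a) ∉ s.contacted

/-- A firm (the first one in the list) whose quota is not filled and which has not yet contacted
every worker of the pool, if there is one. -/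
def DAState.activeFirm (s : DAState N W) (pool : Finset W) (quota : Fin N → ℕ) :
    Option (Fin N) :=
  (List.finRange N).find? fun i =>
    decide ((s.held i).card < quota i ∧ (s.uncontacted pool i).Nonempty)

/-- Firm `i` contacts worker `a`: a free worker accepts, and a matched worker keeps the firm that
she prefers (`workerRank a i` is the rank of firm `i` for worker `a`, lower is better). -/
def DAState.contact (s : DAState N W) (workerRank : W → Fin N → ℕ) (i : Fin N) (a : W) :
    DAState N W where
  contacted := insert (i, a) s.contacted
  partner :=
    match s.partner a with
    | none => Function.update s.partner a (some i)
    | some i' =>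
      if workerRank a i' < workerRank a i then s.partner
      else Function.update s.partner a (some i)

/-- One pass of the loop: an active firm contacts the worker whom it ranks highest among those it
has not yet contacted. If no firm is active, the state does not change any more. -/
def DAState.step (pool : Finset W) (quota : Fin N → ℕ) (firmRank : Fin N → W → ℕ)
    (workerRank : W → Fin N → ℕ) (s : DAState N W) : DAState N W :=
  match s.activeFirm pool quota with
  | none => s
  | some i =>
    match ((s.uncontacted pool i).sort (· ≤ ·)).argmin (firmRank i) with
    | none => s
    | some a => s.contact workerRank i a

/-- Firm-proposing deferred acceptance on a pool of workers. Every pass with an active firm makes a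
contact that was not made before, so that the loop has ended after `N * |W|` passes. -/
def deferredAcceptance (pool : Finset W) (quota : Fin N → ℕ) (firmRank : Fin N → W → ℕ)
    (workerRank : W → Fin N → ℕ) : W → Option (Fin N) :=
  ((DAState.step pool quota firmRank workerRank)^[N * Fintype.card W]
    ⟨∅, fun _ => none⟩).partner

end DeferredAcceptance

/-! ### The market -/

/-- A matching market with `N` firms and `M` types of workers: `K m` workers of type `m`, firm `i`
has the minimum quota `q i m` for type `m` and the total quota `Q i`, and every worker has a known
strict ranking of the firms (a lower rank is better). -/
structure Market (N M : ℕ) where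
  K : Fin M → ℕ
  q : Fin N → Fin M → ℕ
  Q : Fin N → ℕ
  sum_q_le : ∀ i, ∑ m, q i m ≤ Q i
  workerRank : (Σₗ m, Fin (K m)) → Fin N → ℕ
  workerRank_injective : ∀ a, Function.Injective (workerRank a)

namespace Market

variable {N M : ℕ} (𝓜 : Market N M)

/-- The workers `(m, j)`, where `m` is the type and `j` the number within the type (the
lexicographic order only serves to break ties between scores). -/
abbrev Worker : Type := Σₗ m, Fin (𝓜.K m)

/-- The `j`-th worker of type `m`. -/
def worker (m : Fin M) (j : Fin (𝓜.K m)) : 𝓜.Worker := toLex ⟨m, j⟩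

/-- The type of a worker. -/
def typeOf (a : 𝓜.Worker) : Fin M := (ofLex a).1

/-- The set of the workers of type `m`. -/
def workersOfType (m : Fin M) : Finset 𝓜.Worker :=
  Finset.univ.filter fun a => 𝓜.typeOf a = m

/-- Total quota. -/
def totalQuota : ℕ := ∑ i, 𝓜.Q i

/-- Total number of workers. -/
def totalWorkers : ℕ := ∑ m, 𝓜.K m

/-- Largest number of workers of one type. -/
def maxWorkers : ℕ := Finset.univ.sup 𝓜.K

/-- A problem instance: the true matching scores `μ i a` of the pairs of a firm and a worker. -/
abbrev Scores : Type := Fin N → 𝓜.Worker → ℝ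

/-- A matching assigns at most one firm to each worker. -/
def Matching : Type := 𝓜.Worker → Option (Fin N)

instance : MeasurableSpace 𝓜.Matching := ⊤

instance : DiscreteMeasurableSpace 𝓜.Matching := ⟨fun _ => trivial⟩

instance : Countable 𝓜.Matching := inferInstanceAs (Countable (𝓜.Worker → Option (Fin N)))

/-- First match: type-specific deferred acceptance with the quotas `q i m`, in parallel over the
types. `rank S i a` is the rank of worker `a` for firm `i` within the set `S` of workers. -/
def firstMatch (rank : Finset 𝓜.Worker → Fin N → 𝓜.Worker → ℕ) : 𝓜.Matching := fun a =>
  deferredAcceptance (𝓜.workersOfType (𝓜.typeOf a)) (fun i => 𝓜.q i (𝓜.typeOf a))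
    (rank (𝓜.workersOfType (𝓜.typeOf a))) 𝓜.workerRank a

/-- The workers without a firm after the first match. No firm has contacted any of them, because a
worker who has been contacted never becomes free again. -/
def leftWorkers (rank : Finset 𝓜.Worker → Fin N → 𝓜.Worker → ℕ) : Finset 𝓜.Worker :=
  Finset.univ.filter fun a => (𝓜.firstMatch rank a).isNone

/-- The left-over quota of firm `i`. -/
def leftQuota (i : Fin N) : ℕ := 𝓜.Q i - ∑ m, 𝓜.q i m

/-- Second match: deferred acceptance without type consideration on the remaining workers, with the
left-over quotas. -/
def secondMatch (rank : Finset 𝓜.Worker → Fin N → 𝓜.Worker → ℕ) : 𝓜.Matching :=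
  deferredAcceptance (𝓜.leftWorkers rank) 𝓜.leftQuota (rank (𝓜.leftWorkers rank)) 𝓜.workerRank

/-- The two matches merged. -/
def mergedMatch (rank : Finset 𝓜.Worker → Fin N → 𝓜.Worker → ℕ) : 𝓜.Matching := fun a =>
  (𝓜.firstMatch rank a).or (𝓜.secondMatch rank a)

/-- Double matching for the scores `x`: rank the workers by score, then match twice. -/
noncomputable def doubleMatching (x : 𝓜.Scores) : 𝓜.Matching :=
  𝓜.mergedMatch fun S i a => scoreRank S (x i) a

lemma measurable_doubleMatching : Measurable 𝓜.doubleMatching := by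
  classical
  have h : 𝓜.doubleMatching = 𝓜.mergedMatch ∘ fun x S i a => scoreRank S (x i) a := rfl
  rw [h]
  refine Measurable.comp (measurable_of_countable _) ?_
  refine measurable_pi_lambda _ fun S => measurable_pi_lambda _ fun i =>
    measurable_pi_lambda _ fun a => ?_
  simp only [scoreRank, Finset.card_filter]
  refine Finset.measurable_sum _ fun b _ => ?_
  have ha : Measurable fun x : 𝓜.Scores => x i a := by fun_prop
  have hb : Measurable fun x : 𝓜.Scores => x i b := by fun_prop
  refine Measurable.ite ?_ measurable_const measurable_const
  exact (measurableSet_lt ha hb).union ((measurableSet_eq_fun hb ha).inter (MeasurableSet.const _))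

/-! ### Rewards, histories and the algorithm -/

/-- Law of the rewards of one round. Given the instance `μ` and the matching `u`, the pair of firm
`i` and a worker `a` matched with it yields a reward with law `ρ i a (μ i a)`, independently over
the matched pairs; an unmatched worker yields no reward (recorded as `0`). -/
noncomputable def rewardMeasure (ρ : Fin N → 𝓜.Worker → Kernel ℝ ℝ) (μ : 𝓜.Scores)
    (u : 𝓜.Matching) : Measure (𝓜.Worker → ℝ) :=
  Measure.pi fun a => (u a).elim (Measure.dirac 0) fun i => ρ i a (μ i a)

variable (ρ : Fin N → 𝓜.Worker → Kernel ℝ ℝ) [∀ i a, IsMarkovKernel (ρ i a)]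

lemma isProbabilityMeasure_factor (μ : 𝓜.Scores) (u : 𝓜.Matching) (a : 𝓜.Worker) :
    IsProbabilityMeasure ((u a).elim (Measure.dirac (0 : ℝ)) fun i => ρ i a (μ i a)) := by
  cases u a <;> simp only [Option.elim] <;> infer_instance

instance (μ : 𝓜.Scores) (u : 𝓜.Matching) : IsProbabilityMeasure (𝓜.rewardMeasure ρ μ u) := by
  have := 𝓜.isProbabilityMeasure_factor ρ μ u
  unfold rewardMeasure
  infer_instance

lemma measurable_rewardMeasure :
    Measurable fun p : 𝓜.Scores × 𝓜.Matching => 𝓜.rewardMeasure ρ p.1 p.2 := by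
  refine measurable_from_prod_countable_left fun u => ?_
  refine Measurable.measure_of_isPiSystem_of_isProbabilityMeasure generateFrom_pi.symm
    isPiSystem_pi ?_
  rintro _ ⟨s, hs, rfl⟩
  have hs' : ∀ a, MeasurableSet (s a) := fun a => hs a (Set.mem_univ a)
  have := fun μ => 𝓜.isProbabilityMeasure_factor ρ μ u
  simp only [rewardMeasure, Measure.pi_pi]
  refine Finset.measurable_prod _ fun a _ => ?_
  cases u a with
  | none => exact measurable_const
  | some i =>
    exact ((ρ i a).measurable_coe (hs' a)).comp
      (by fun_prop : Measurable fun μ : 𝓜.Scores => μ i a)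

/-- The law of the rewards as a kernel. -/
noncomputable def rewardKernel : Kernel (𝓜.Scores × 𝓜.Matching) (𝓜.Worker → ℝ) where
  toFun p := 𝓜.rewardMeasure ρ p.1 p.2
  measurable' := 𝓜.measurable_rewardMeasure ρ

instance : IsMarkovKernel (𝓜.rewardKernel ρ) :=
  ⟨fun p => inferInstanceAs (IsProbabilityMeasure (𝓜.rewardMeasure ρ p.1 p.2))⟩

/-- What the platform observes in one round: the matching and the rewards. -/
abbrev Round : Type := 𝓜.Matching × (𝓜.Worker → ℝ)

/-- The history of the first `t` rounds. -/
abbrev History (t : ℕ) : Type := Fin t → 𝓜.Round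

/-- The history extended by one round. -/
def extend {t : ℕ} (p : 𝓜.History t × 𝓜.Round) : 𝓜.History (t + 1) :=
  Fin.snoc (α := fun _ => 𝓜.Round) p.1 p.2

lemma measurable_extend {t : ℕ} : Measurable (𝓜.extend (t := t)) := by
  refine measurable_pi_lambda _ fun k => ?_
  refine Fin.lastCases ?_ (fun j => ?_) k
  · simpa [extend] using measurable_snd
  · have h : Measurable fun p : 𝓜.History t × 𝓜.Round => p.1 j :=
      (measurable_pi_apply j).comp measurable_fst
    simpa [extend] using h

/-- The matching recommended by the algorithm when its belief about the scores is `belief h`: draw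
sampled scores from the belief and apply double matching to them. -/
noncomputable def recommend {t : ℕ} (belief : Kernel (𝓜.History t) 𝓜.Scores) :
    Kernel (𝓜.History t) 𝓜.Matching :=
  belief.map 𝓜.doubleMatching

instance {t : ℕ} (belief : Kernel (𝓜.History t) 𝓜.Scores) [IsMarkovKernel belief] :
    IsMarkovKernel (𝓜.recommend belief) :=
  Kernel.IsMarkovKernel.map _ 𝓜.measurable_doubleMatching

/-- One round, given the true scores and the history: recommend a matching, which may depend on the
history only, and collect the rewards. -/
noncomputable def roundKernel {t : ℕ} (belief : Kernel (𝓜.History t) 𝓜.Scores) :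
    Kernel (𝓜.Scores × 𝓜.History t) 𝓜.Round :=
  (𝓜.recommend belief).prodMkLeft 𝓜.Scores ⊗ₖ
    (𝓜.rewardKernel ρ).comap (fun p => (p.1.1, p.2)) (by fun_prop)

instance {t : ℕ} (belief : Kernel (𝓜.History t) 𝓜.Scores) [IsMarkovKernel belief] :
    IsMarkovKernel (𝓜.roundKernel ρ belief) := by
  unfold roundKernel
  infer_instance

/-- Conditional law, given the true scores, of the history extended by one round. -/
noncomputable def extendKernel {t : ℕ} (κ : Kernel 𝓜.Scores (𝓜.History t))
    (belief : Kernel (𝓜.History t) 𝓜.Scores) : Kernel 𝓜.Scores (𝓜.History (t + 1)) :=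
  (κ ⊗ₖ 𝓜.roundKernel ρ belief).map 𝓜.extend

instance {t : ℕ} (κ : Kernel 𝓜.Scores (𝓜.History t)) [IsMarkovKernel κ]
    (belief : Kernel (𝓜.History t) 𝓜.Scores) [IsMarkovKernel belief] :
    IsMarkovKernel (𝓜.extendKernel ρ κ belief) :=
  Kernel.IsMarkovKernel.map _ 𝓜.measurable_extend

variable (prior : Measure 𝓜.Scores) [IsProbabilityMeasure prior]

/-- The law of the history under Thompson sampling with double matching, bundled with the fact that
it consists of probability measures: in each round the belief is the Bayesian posterior of the
scores given the history so far. -/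
noncomputable def mmtsAux :
    (t : ℕ) → {κ : Kernel 𝓜.Scores (𝓜.History t) // IsMarkovKernel κ}
  | 0 => ⟨Kernel.const _ (Measure.dirac Fin.elim0), inferInstance⟩
  | t + 1 =>
    have := (mmtsAux t).2
    ⟨𝓜.extendKernel ρ (mmtsAux t).1 (posterior (mmtsAux t).1 prior), inferInstance⟩

/-- Conditional law of the first `t` rounds given the true scores, when all firms follow Thompson
sampling with double matching. -/
noncomputable def mmts (t : ℕ) : Kernel 𝓜.Scores (𝓜.History t) := (𝓜.mmtsAux ρ prior t).1

instance (t : ℕ) : IsMarkovKernel (𝓜.mmts ρ prior t) := (𝓜.mmtsAux ρ prior t).2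

/-- The defining recursion of the algorithm: in round `t + 1` the belief is the posterior given the
first `t` rounds. -/
lemma mmts_succ (t : ℕ) :
    𝓜.mmts ρ prior (t + 1) =
      𝓜.extendKernel ρ (𝓜.mmts ρ prior t) (posterior (𝓜.mmts ρ prior t) prior) := rfl

/-! ### Regret -/

/-- Total true score, for firm `i`, of the workers of type `m` whom it gets in the matching `u`. -/
def typeScore (μ : 𝓜.Scores) (i : Fin N) (m : Fin M) (u : 𝓜.Matching) : ℝ :=
  ∑ j : Fin (𝓜.K m), if u (𝓜.worker m j) = some i then μ i (𝓜.worker m j) else 0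

/-- Regret of firm `i` with the workers of type `m` over `T` rounds on the instance `μ`: the
expected score difference between the firm-optimal matching, which is the double matching for the
true scores, and the recommended matchings. -/
noncomputable def firmTypeRegret (i : Fin N) (m : Fin M) (T : ℕ) (μ : 𝓜.Scores) : ℝ :=
  ∫ h, ∑ t : Fin T, (𝓜.typeScore μ i m (𝓜.doubleMatching μ) - 𝓜.typeScore μ i m (h t).1)
    ∂(𝓜.mmts ρ prior T μ)

/-- Total regret of firm `i` on the instance `μ`. -/
noncomputable def firmRegret (i : Fin N) (T : ℕ) (μ : 𝓜.Scores) : ℝ :=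
  ∑ m, 𝓜.firmTypeRegret ρ prior i m T μ

/-- Bayesian social welfare gap: the expectation over the prior of the regret of all firms. -/
noncomputable def socialWelfareGap (T : ℕ) : ℝ :=
  ∫ μ, ∑ i, 𝓜.firmRegret ρ prior i T μ ∂prior

end Market

end CMCPR

/-!
The proof is the upper-confidence-bound analysis of Thompson sampling. Given the history, the
recommended matching has the same law as the benchmark `doubleMatching μ` (`map_recommendLaw`), so
any weights that are functions of the history have the same expected total over the two matchings.
Taking upper confidence bounds as the weights, the loss of a round splits into the amount by which
the true scores exceed the bounds on the benchmark and the amount by which the bounds exceed the true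
scores on the recommended matching (`integral_gap_le`).

All confidence bounds come from one tilt `α` of the exponential supermartingale `expDeviation` of
each firm-worker pair (`lintegral_expDeviation_le`). After `n` matches the bound exceeds the score by
about `α / 2 + (1 + 2 L / α) / (n + 1)`. Because the tilt is fixed, no union bound over `n` and no
tail estimate is needed: the exponential itself dominates the excess beyond the level `L`
(`le_ucb_add`, `ucb_le_add`). Along the rounds the terms `1 / (n + 1)` add up to harmonic numbers,
which serve as a potential (`integral_sum_gap_sub_potential_le`), and the terms `α / 2` contribute at
most `α Q / 2` per round, since double matching respects the quotas
(`matchingSize_doubleMatching_le`).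

With `L = log (Q T)` and `α` proportional to `log (Q T) √(K_max / T)` this gives the bound, because
the number `N K` of pairs is at most `Q K_max` when every firm has a position per type
(`mul_totalWorkers_le`). Short horizons are covered by the trivial bound `Q T`; the summand `N K / Q`
is needed only if `Q = T = 1`.
-/

namespace CMCPR

/-! ### Quotas and the size of a matching -/

section DeferredAcceptance

variable {N : ℕ} {W : Type} [Fintype W] [LinearOrder W]

omit [Fintype W] in
lemma DAState.partner_contact (s : DAState N W) (workerRank : W → Fin N → ℕ) {i k : Fin N} {a b : W}
    (h : (s.contact workerRank i a).partner b = some k) :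
    (b = a ∧ k = i) ∨ s.partner b = some k := by
  unfold DAState.contact at h
  dsimp only at h
  by_cases hba : b = a
  · subst hba
    cases hp : s.partner b with
    | none =>
      rw [hp] at h
      simp only [Function.update_self, Option.some.injEq] at h
      exact Or.inl ⟨rfl, h.symm⟩
    | some i' =>
      rw [hp] at h
      dsimp only at h
      split_ifs at h
      · exact Or.inr (hp ▸ h)
      · simp only [Function.update_self, Option.some.injEq] at h
        exact Or.inl ⟨rfl, h.symm⟩
  · right
    cases hp : s.partner a with
    | none =>
      rw [hp] at h
      simpa [Function.update_of_ne hba] using h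
    | some i' =>
      rw [hp] at h
      dsimp only at h
      split_ifs at h
      · exact h
      · simpa [Function.update_of_ne hba] using h

lemma DAState.held_contact_self (s : DAState N W) (workerRank : W → Fin N → ℕ) (i : Fin N) (a : W) :
    (s.contact workerRank i a).held i ⊆ insert a (s.held i) := by
  intro b hb
  simp only [DAState.held, Finset.mem_filter, Finset.mem_univ, true_and, Finset.mem_insert] at hb ⊢
  exact (s.partner_contact workerRank hb).imp_left And.left

lemma DAState.held_contact_of_ne (s : DAState N W) (workerRank : W → Fin N → ℕ) {i k : Fin N}
    (hk : k ≠ i) (a : W) : (s.contact workerRank i a).held k ⊆ s.held k := by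
  intro b hb
  simp only [DAState.held, Finset.mem_filter, Finset.mem_univ, true_and] at hb ⊢
  exact (s.partner_contact workerRank hb).resolve_left fun h => hk h.2

lemma DAState.card_held_step_le (pool : Finset W) (quota : Fin N → ℕ) (firmRank : Fin N → W → ℕ)
    (workerRank : W → Fin N → ℕ) (s : DAState N W) (hs : ∀ i, (s.held i).card ≤ quota i)
    (k : Fin N) : ((s.step pool quota firmRank workerRank).held k).card ≤ quota k := by
  unfold DAState.step
  split
  · exact hs k
  · rename_i i hi
    split
    · exact hs k
    · rename_i a _
      have hlt : (s.held i).card < quota i := by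
        have := List.find?_some hi
        simp only [decide_eq_true_eq] at this
        exact this.1
      by_cases hk : k = i
      · subst hk
        exact (Finset.card_le_card (s.held_contact_self workerRank k a)).trans
          ((Finset.card_insert_le _ _).trans hlt)
      · exact (Finset.card_le_card (s.held_contact_of_ne workerRank hk a)).trans (hs k)

/-- Deferred acceptance respects the quotas, because only a firm with a vacant position makes a
contact. -/
lemma card_deferredAcceptance_le (pool : Finset W) (quota : Fin N → ℕ) (firmRank : Fin N → W → ℕ)
    (workerRank : W → Fin N → ℕ) (i : Fin N) :
    (Finset.univ.filter fun a =>
      deferredAcceptance pool quota firmRank workerRank a = some i).card ≤ quota i := by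
  have h : ∀ n k, (((DAState.step pool quota firmRank workerRank)^[n]
      ⟨∅, fun _ => none⟩).held k).card ≤ quota k := by
    intro n
    induction n with
    | zero => intro k; simp [DAState.held]
    | succ n ih =>
      intro k
      rw [Function.iterate_succ_apply']
      exact DAState.card_held_step_le pool quota firmRank workerRank _ ih k
  exact h _ i

end DeferredAcceptance

namespace Market

variable {N M : ℕ} (𝓜 : Market N M)

open Classical in
lemma card_mergedMatch_eq_some_le (rank : Finset 𝓜.Worker → Fin N → 𝓜.Worker → ℕ) (i : Fin N) :
    (Finset.univ.filter fun a : 𝓜.Worker => 𝓜.mergedMatch rank a = some i).card ≤ 𝓜.Q i := by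
  have hsub : (Finset.univ.filter fun a => 𝓜.mergedMatch rank a = some i) ⊆
      (Finset.univ.biUnion fun m => Finset.univ.filter fun a =>
        deferredAcceptance (𝓜.workersOfType m) (fun i => 𝓜.q i m)
          (rank (𝓜.workersOfType m)) 𝓜.workerRank a = some i) ∪
      Finset.univ.filter fun a => deferredAcceptance (𝓜.leftWorkers rank) 𝓜.leftQuota
        (rank (𝓜.leftWorkers rank)) 𝓜.workerRank a = some i := by
    intro a ha
    simp only [mergedMatch, Finset.mem_filter, Finset.mem_univ, true_and, Option.or_eq_some_iff,
      Finset.mem_union, Finset.mem_biUnion] at ha ⊢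
    exact ha.imp (fun h => ⟨𝓜.typeOf a, h⟩) fun h => h.2
  refine (Finset.card_le_card hsub).trans <| (Finset.card_union_le _ _).trans ?_
  have h1 : (Finset.univ.biUnion fun m => Finset.univ.filter fun a =>
        deferredAcceptance (𝓜.workersOfType m) (fun i => 𝓜.q i m)
          (rank (𝓜.workersOfType m)) 𝓜.workerRank a = some i).card ≤ ∑ m, 𝓜.q i m :=
    Finset.card_biUnion_le.trans <| Finset.sum_le_sum fun m _ =>
      card_deferredAcceptance_le _ _ _ _ i
  have h2 := card_deferredAcceptance_le (𝓜.leftWorkers rank) 𝓜.leftQuota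
    (rank (𝓜.leftWorkers rank)) 𝓜.workerRank i
  have h3 := 𝓜.sum_q_le i
  have h4 : 𝓜.leftQuota i = 𝓜.Q i - ∑ m, 𝓜.q i m := rfl
  omega

/-- The number of workers employed in a matching. -/
def matchingSize (u : 𝓜.Matching) : ℕ := (Finset.univ.filter fun a => (u a).isSome).card

lemma matchingSize_doubleMatching_le (x : 𝓜.Scores) :
    𝓜.matchingSize (𝓜.doubleMatching x) ≤ 𝓜.totalQuota := by
  classical
  have hsub : (Finset.univ.filter fun a => (𝓜.doubleMatching x a).isSome) ⊆
      Finset.univ.biUnion fun i => Finset.univ.filter fun a => 𝓜.doubleMatching x a = some i := by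
    intro a ha
    simpa [Option.isSome_iff_exists] using ha
  exact (Finset.card_le_card hsub).trans <| Finset.card_biUnion_le.trans <|
    Finset.sum_le_sum fun i _ => 𝓜.card_mergedMatch_eq_some_le _ i

lemma card_worker : Fintype.card 𝓜.Worker = 𝓜.totalWorkers := by
  have : Fintype.card 𝓜.Worker = Fintype.card (Σ m, Fin (𝓜.K m)) :=
    Fintype.card_congr ofLex
  rw [this, Fintype.card_sigma]
  simp [totalWorkers]

/-- With at least one position per type at each firm, the firm-worker pairs number at most
`Q * K_max`. -/
lemma mul_totalWorkers_le (hQ : ∀ i, M ≤ 𝓜.Q i) :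
    N * 𝓜.totalWorkers ≤ 𝓜.totalQuota * 𝓜.maxWorkers := by
  have h1 : 𝓜.totalWorkers ≤ M * 𝓜.maxWorkers := by
    have : ∑ m, 𝓜.K m ≤ ∑ _m : Fin M, 𝓜.maxWorkers :=
      Finset.sum_le_sum fun m _ => Finset.le_sup (f := 𝓜.K) (Finset.mem_univ m)
    simpa [totalWorkers] using this
  have h2 : N * M ≤ 𝓜.totalQuota := by
    have : ∑ _i : Fin N, M ≤ ∑ i, 𝓜.Q i := Finset.sum_le_sum fun i _ => hQ i
    simpa [totalQuota] using this
  calc N * 𝓜.totalWorkers ≤ N * (M * 𝓜.maxWorkers) := by gcongr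
    _ = N * M * 𝓜.maxWorkers := by ring
    _ ≤ _ := by gcongr

/-! ### Total score of a matching -/

/-- The total of the weights `w i a` over the pairs of a firm `i` and a worker `a` matched by `u`.
The weights are the true scores, or confidence bounds for them. -/
def score (w : 𝓜.Scores) (u : 𝓜.Matching) : ℝ := ∑ a, (u a).elim 0 fun i => w i a

lemma score_eq_sum_ite (w : 𝓜.Scores) (u : 𝓜.Matching) :
    𝓜.score w u = ∑ i, ∑ a, if u a = some i then w i a else 0 := by
  rw [Finset.sum_comm]
  refine Finset.sum_congr rfl fun a _ => ?_
  cases h : u a with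
  | none => simp
  | some k => simp

lemma sum_typeScore (μ : 𝓜.Scores) (u : 𝓜.Matching) :
    ∑ i, ∑ m, 𝓜.typeScore μ i m u = 𝓜.score μ u := by
  rw [score_eq_sum_ite]
  refine Finset.sum_congr rfl fun i _ => ?_
  rw [← Equiv.sum_comp (toLex : (Σ m, Fin (𝓜.K m)) ≃ 𝓜.Worker), Fintype.sum_sigma]
  rfl

lemma score_mono {w w' : 𝓜.Scores} (h : ∀ i a, w i a ≤ w' i a) (u : 𝓜.Matching) :
    𝓜.score w u ≤ 𝓜.score w' u := by
  refine Finset.sum_le_sum fun a _ => ?_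
  cases u a with
  | none => simp
  | some k => exact h k a

lemma score_add (w w' : 𝓜.Scores) (u : 𝓜.Matching) :
    𝓜.score (fun i a => w i a + w' i a) u = 𝓜.score w u + 𝓜.score w' u := by
  simp only [score, ← Finset.sum_add_distrib]
  refine Finset.sum_congr rfl fun a _ => ?_
  cases u a <;> simp

lemma score_mul_left (c : ℝ) (w : 𝓜.Scores) (u : 𝓜.Matching) :
    𝓜.score (fun i a => c * w i a) u = c * 𝓜.score w u := by
  simp only [score, Finset.mul_sum]
  refine Finset.sum_congr rfl fun a _ => ?_
  cases u a <;> simp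

lemma score_const (c : ℝ) (u : 𝓜.Matching) :
    𝓜.score (fun _ _ => c) u = c * 𝓜.matchingSize u := by
  simp only [score, matchingSize, Finset.card_filter, Nat.cast_sum, Finset.mul_sum]
  refine Finset.sum_congr rfl fun a _ => ?_
  cases u a <;> simp

lemma score_nonneg {w : 𝓜.Scores} (h : ∀ i a, 0 ≤ w i a) (u : 𝓜.Matching) : 0 ≤ 𝓜.score w u := by
  simpa [score_const] using 𝓜.score_mono h u

lemma score_le_matchingSize {w : 𝓜.Scores} (h : ∀ i a, w i a ≤ 1) (u : 𝓜.Matching) :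
    𝓜.score w u ≤ 𝓜.matchingSize u := by
  simpa [score_const] using 𝓜.score_mono h u

lemma score_le_sum {w : 𝓜.Scores} (h : ∀ i a, 0 ≤ w i a) (u : 𝓜.Matching) :
    𝓜.score w u ≤ ∑ i, ∑ a, w i a := by
  rw [score_eq_sum_ite]
  refine Finset.sum_le_sum fun i _ => Finset.sum_le_sum fun a _ => ?_
  split_ifs
  exacts [le_rfl, h i a]

lemma abs_score_le {w : 𝓜.Scores} (h : ∀ i a, w i a ∈ Set.Icc (0 : ℝ) 1) (u : 𝓜.Matching) :
    |𝓜.score w u| ≤ Fintype.card 𝓜.Worker := by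
  rw [abs_of_nonneg (𝓜.score_nonneg (fun i a => (h i a).1) u)]
  refine (𝓜.score_le_matchingSize (fun i a => (h i a).2) u).trans ?_
  exact_mod_cast Finset.card_le_univ _

lemma measurable_score : Measurable fun p : 𝓜.Scores × 𝓜.Matching => 𝓜.score p.1 p.2 := by
  refine measurable_from_prod_countable_left fun u => ?_
  simp only [score]
  refine Finset.measurable_sum _ fun a _ => ?_
  cases u a with
  | none => exact measurable_const
  | some i => simp only [Option.elim]; fun_prop

/-! ### Statistics of a history -/

section Statistics

/-- The number of rounds in which firm `i` and worker `a` were matched. -/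
def pulls (i : Fin N) (a : 𝓜.Worker) {t : ℕ} (h : 𝓜.History t) : ℕ :=
  ∑ s, if (h s).1 a = some i then 1 else 0

/-- The sum of the rewards which the pair of firm `i` and worker `a` has yielded. -/
def rewardSum (i : Fin N) (a : 𝓜.Worker) {t : ℕ} (h : 𝓜.History t) : ℝ :=
  ∑ s, if (h s).1 a = some i then (h s).2 a else 0

lemma extend_castSucc {t : ℕ} (p : 𝓜.History t × 𝓜.Round) (s : Fin t) :
    𝓜.extend p s.castSucc = p.1 s :=
  Fin.snoc_castSucc (α := fun _ => 𝓜.Round) _ _ _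

lemma extend_last {t : ℕ} (p : 𝓜.History t × 𝓜.Round) : 𝓜.extend p (Fin.last t) = p.2 :=
  Fin.snoc_last (α := fun _ => 𝓜.Round) _ _

lemma pulls_extend (i : Fin N) (a : 𝓜.Worker) {t : ℕ} (h : 𝓜.History t) (r : 𝓜.Round) :
    𝓜.pulls i a (𝓜.extend (h, r)) = 𝓜.pulls i a h + if r.1 a = some i then 1 else 0 := by
  simp [pulls, extend, Fin.sum_univ_castSucc]

lemma rewardSum_extend (i : Fin N) (a : 𝓜.Worker) {t : ℕ} (h : 𝓜.History t) (r : 𝓜.Round) :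
    𝓜.rewardSum i a (𝓜.extend (h, r)) =
      𝓜.rewardSum i a h + if r.1 a = some i then r.2 a else 0 := by
  simp [rewardSum, extend, Fin.sum_univ_castSucc]

lemma pulls_le (i : Fin N) (a : 𝓜.Worker) {t : ℕ} (h : 𝓜.History t) : 𝓜.pulls i a h ≤ t := by
  have : 𝓜.pulls i a h ≤ ∑ _s : Fin t, 1 := Finset.sum_le_sum fun s _ => by split_ifs <;> simp
  simpa using this

lemma measurableSet_matched (i : Fin N) (a : 𝓜.Worker) {t : ℕ} (s : Fin t) :
    MeasurableSet {h : 𝓜.History t | (h s).1 a = some i} :=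
  (measurable_fst.comp (measurable_pi_apply s))
    (MeasurableSet.of_discrete : MeasurableSet {u : 𝓜.Matching | u a = some i})

lemma measurable_pulls (i : Fin N) (a : 𝓜.Worker) {t : ℕ} :
    Measurable fun h : 𝓜.History t => 𝓜.pulls i a h :=
  Finset.measurable_sum _ fun s _ =>
    Measurable.ite (𝓜.measurableSet_matched i a s) measurable_const measurable_const

lemma measurable_rewardSum (i : Fin N) (a : 𝓜.Worker) {t : ℕ} :
    Measurable fun h : 𝓜.History t => 𝓜.rewardSum i a h :=
  Finset.measurable_sum _ fun s _ =>
    Measurable.ite (𝓜.measurableSet_matched i a s)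
      ((measurable_pi_apply a).comp (measurable_snd.comp (measurable_pi_apply s))) measurable_const

/-- The exponential supermartingale of the centred rewards of a pair with true score `x`, for
rewards whose noise has variance proxy at most `1 / 2`. -/
noncomputable def expDeviation (θ : ℝ) (i : Fin N) (a : 𝓜.Worker) (x : ℝ) {t : ℕ}
    (h : 𝓜.History t) : ℝ :=
  Real.exp (θ * (𝓜.rewardSum i a h - x * 𝓜.pulls i a h) - θ ^ 2 / 4 * 𝓜.pulls i a h)

lemma expDeviation_nonneg (θ : ℝ) (i : Fin N) (a : 𝓜.Worker) (x : ℝ) {t : ℕ} (h : 𝓜.History t) :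
    0 ≤ 𝓜.expDeviation θ i a x h := (Real.exp_pos _).le

lemma measurable_expDeviation (θ : ℝ) (i : Fin N) (a : 𝓜.Worker) {t : ℕ} :
    Measurable fun p : ℝ × 𝓜.History t => 𝓜.expDeviation θ i a p.1 p.2 := by
  have h1 : Measurable fun p : ℝ × 𝓜.History t => 𝓜.rewardSum i a p.2 :=
    (𝓜.measurable_rewardSum i a).comp measurable_snd
  have h2 : Measurable fun p : ℝ × 𝓜.History t => (𝓜.pulls i a p.2 : ℝ) :=
    (measurable_of_countable (fun n : ℕ => (n : ℝ))).comp
      ((𝓜.measurable_pulls i a (t := t)).comp measurable_snd)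
  exact (((h1.sub (measurable_fst.mul h2)).const_mul θ).sub (h2.const_mul (θ ^ 2 / 4))).exp

lemma expDeviation_extend (θ : ℝ) (i : Fin N) (a : 𝓜.Worker) (x : ℝ) {t : ℕ}
    (h : 𝓜.History t) (r : 𝓜.Round) :
    𝓜.expDeviation θ i a x (𝓜.extend (h, r)) = 𝓜.expDeviation θ i a x h *
      if r.1 a = some i then Real.exp (θ * (r.2 a - x) - θ ^ 2 / 4) else 1 := by
  unfold expDeviation
  rw [pulls_extend, rewardSum_extend]
  split_ifs
  · rw [← Real.exp_add]
    push_cast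
    ring_nf
  · simp

/-- The upper confidence bound for the score of a pair, clipped to `[0, 1]`. After `n` matches with
reward sum `Y` it is `(Y + 1 + α n / 4 + L / α) / (n + 1)`: the tilt `α` is the same for all `n`,
and the extra `1` in numerator and denominator covers the case `n = 0`. -/
noncomputable def ucb (α L : ℝ) {t : ℕ} (h : 𝓜.History t) : 𝓜.Scores := fun i a =>
  max 0 (min 1 ((𝓜.rewardSum i a h + 1 + α * 𝓜.pulls i a h / 4 + L / α) / (𝓜.pulls i a h + 1)))

lemma ucb_mem (α L : ℝ) {t : ℕ} (h : 𝓜.History t) (i : Fin N) (a : 𝓜.Worker) :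
    𝓜.ucb α L h i a ∈ Set.Icc (0 : ℝ) 1 :=
  ⟨le_max_left _ _, max_le zero_le_one (min_le_left _ _)⟩

lemma measurable_ucb (α L : ℝ) {t : ℕ} : Measurable fun h : 𝓜.History t => 𝓜.ucb α L h := by
  refine measurable_pi_lambda _ fun i => measurable_pi_lambda _ fun a => ?_
  have h1 := 𝓜.measurable_rewardSum i a (t := t)
  have h2 : Measurable fun h : 𝓜.History t => (𝓜.pulls i a h : ℝ) :=
    (measurable_of_countable (fun n : ℕ => (n : ℝ))).comp (𝓜.measurable_pulls i a)
  unfold ucb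
  fun_prop

/-- The exponential deviation dominates the linear excess over the level `L`, so that no tail
estimate is needed. -/
lemma le_exp_neg_mul_exp {α L : ℝ} (hα : 0 < α) (y : ℝ) :
    (y - L) / α ≤ Real.exp (-L) / α * Real.exp y := by
  rw [div_mul_eq_mul_div, ← Real.exp_add]
  gcongr
  have := Real.add_one_le_exp (-L + y)
  linarith

lemma le_ucb_add {α L : ℝ} (hα : 0 < α) {t : ℕ} (h : 𝓜.History t) (i : Fin N) (a : 𝓜.Worker)
    {x : ℝ} (hx : x ∈ Set.Icc (0 : ℝ) 1) :
    x ≤ 𝓜.ucb α L h i a + Real.exp (-L) / α * 𝓜.expDeviation (-α) i a x h := by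
  set n : ℝ := (𝓜.pulls i a h : ℝ)
  set Y := 𝓜.rewardSum i a h
  set Z := Real.exp (-L) / α * 𝓜.expDeviation (-α) i a x h
  have hn0 : 0 ≤ n := Nat.cast_nonneg _
  have hZ0 : 0 ≤ Z := by unfold Z expDeviation; positivity
  have hdev : (-α * (Y - x * n) - (-α) ^ 2 / 4 * n - L) / α ≤ Z := le_exp_neg_mul_exp hα _
  have hdev' : -(Y - x * n) - α / 4 * n - L / α ≤ Z := by
    refine le_of_eq_of_le ?_ hdev
    field_simp
  have key : x - Z ≤ (Y + 1 + α * n / 4 + L / α) / (n + 1) := by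
    rw [le_div_iff₀ (by positivity)]
    nlinarith [mul_nonneg hZ0 hn0, hx.2]
  have : x - Z ≤ 𝓜.ucb α L h i a :=
    le_max_of_le_right (le_min (by linarith [hx.2]) key)
  linarith

lemma ucb_le_add {α L : ℝ} (hα : 0 < α) (hL : 0 ≤ L) {t : ℕ} (h : 𝓜.History t) (i : Fin N)
    (a : 𝓜.Worker) {x : ℝ} (hx : x ∈ Set.Icc (0 : ℝ) 1) :
    𝓜.ucb α L h i a ≤ x + (α / 2 + ((1 + 2 * L / α) * (1 / (𝓜.pulls i a h + 1)) +
      Real.exp (-L) / α * 𝓜.expDeviation α i a x h)) := by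
  set n : ℝ := (𝓜.pulls i a h : ℝ)
  set Y := 𝓜.rewardSum i a h
  set Z := Real.exp (-L) / α * 𝓜.expDeviation α i a x h
  have hn0 : 0 ≤ n := Nat.cast_nonneg _
  have hZ0 : 0 ≤ Z := by unfold Z expDeviation; positivity
  have hdev : (α * (Y - x * n) - α ^ 2 / 4 * n - L) / α ≤ Z := le_exp_neg_mul_exp hα _
  have hdev' : (Y - x * n) - α / 4 * n - L / α ≤ Z := by
    refine le_of_eq_of_le ?_ hdev
    field_simp
  have hL' : 0 ≤ L / α := by positivity
  have h0 : 0 ≤ x + (α / 2 + ((1 + 2 * L / α) * (1 / (n + 1)) + Z)) := by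
    have := hx.1
    positivity
  refine max_le h0 ((min_le_right _ _).trans ?_)
  rw [div_le_iff₀ (by positivity)]
  have e : (x + (α / 2 + ((1 + 2 * L / α) * (1 / (n + 1)) + Z))) * (n + 1) =
      x * (n + 1) + α / 2 * (n + 1) + (1 + 2 * (L / α)) + Z * (n + 1) := by
    field_simp
    ring
  rw [e]
  nlinarith [mul_nonneg hZ0 hn0, hx.1, hx.2]

end Statistics

/-! ### Concentration -/

section Concentration

variable (ρ : Fin N → 𝓜.Worker → Kernel ℝ ℝ) [∀ i a, IsMarkovKernel (ρ i a)]
variable (prior : Measure 𝓜.Scores) [IsProbabilityMeasure prior]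

lemma lintegral_exp_centred_le {σ : ℝ≥0} (hσ : σ ^ 2 ≤ 1 / 2) {ν : Measure ℝ} {x : ℝ}
    (h : HasSubgaussianMGF (fun y => y - x) (σ ^ 2) ν) (θ : ℝ) :
    ∫⁻ y, ENNReal.ofReal (Real.exp (θ * (y - x) - θ ^ 2 / 4)) ∂ν ≤ 1 := by
  have hσ' : ((σ ^ 2 : ℝ≥0) : ℝ) ≤ 1 / 2 := by exact_mod_cast hσ
  have e : ∀ y, Real.exp (θ * (y - x) - θ ^ 2 / 4) =
      Real.exp (-(θ ^ 2 / 4)) * Real.exp (θ * (y - x)) := fun y => by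
    rw [← Real.exp_add]; ring_nf
  simp only [e]
  rw [← ofReal_integral_eq_lintegral_ofReal ((h.integrable_exp_mul θ).const_mul _)
    (ae_of_all _ fun y => by positivity), integral_const_mul, ENNReal.ofReal_le_one]
  calc Real.exp (-(θ ^ 2 / 4)) * ∫ y, Real.exp (θ * (y - x)) ∂ν
      ≤ Real.exp (-(θ ^ 2 / 4)) * Real.exp (((σ ^ 2 : ℝ≥0) : ℝ) * θ ^ 2 / 2) := by
        gcongr
        exact h.mgf_le θ
    _ = Real.exp (-(θ ^ 2 / 4) + ((σ ^ 2 : ℝ≥0) : ℝ) * θ ^ 2 / 2) := (Real.exp_add _ _).symm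
    _ ≤ 1 := Real.exp_le_one_iff.2 (by nlinarith [sq_nonneg θ])

/-- The expected exponential deviation is at most `1` whatever matchings the algorithm chooses: a
round multiplies it by a factor of conditional mean at most `1`. -/
lemma lintegral_expDeviation_le {σ : ℝ≥0} (hσ : σ ^ 2 ≤ 1 / 2)
    (hρ : ∀ i a, ∀ x ∈ Set.Icc (0 : ℝ) 1,
      HasSubgaussianMGF (fun y => y - x) (σ ^ 2) (ρ i a x))
    (θ : ℝ) (i : Fin N) (a : 𝓜.Worker) {μ : 𝓜.Scores} (hμ : μ i a ∈ Set.Icc (0 : ℝ) 1) (t : ℕ) :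
    ∫⁻ h, ENNReal.ofReal (𝓜.expDeviation θ i a (μ i a) h) ∂(𝓜.mmts ρ prior t μ) ≤ 1 := by
  have hmeas : ∀ t, Measurable fun h : 𝓜.History t =>
      ENNReal.ofReal (𝓜.expDeviation θ i a (μ i a) h) := fun t =>
    ((𝓜.measurable_expDeviation θ i a).comp measurable_prodMk_left).ennreal_ofReal
  induction t with
  | zero => simp [expDeviation, pulls, rewardSum]
  | succ t ih =>
    have hround : ∀ h : 𝓜.History t, ∫⁻ r, ENNReal.ofReal
        (𝓜.expDeviation θ i a (μ i a) (𝓜.extend (h, r)))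
        ∂(𝓜.roundKernel ρ (posterior (𝓜.mmts ρ prior t) prior) (μ, h)) ≤
        ENNReal.ofReal (𝓜.expDeviation θ i a (μ i a) h) := by
      intro h
      have hm : Measurable fun r : 𝓜.Round => ENNReal.ofReal
          (𝓜.expDeviation θ i a (μ i a) (𝓜.extend (h, r))) :=
        (hmeas (t + 1)).comp (𝓜.measurable_extend.comp measurable_prodMk_left)
      rw [roundKernel, Kernel.lintegral_compProd _ _ _ hm]
      have hreward : ∀ u : 𝓜.Matching, ∫⁻ y, ENNReal.ofReal
          (𝓜.expDeviation θ i a (μ i a) (𝓜.extend (h, (u, y)))) ∂(𝓜.rewardMeasure ρ μ u) ≤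
          ENNReal.ofReal (𝓜.expDeviation θ i a (μ i a) h) := by
        intro u
        simp only [expDeviation_extend]
        by_cases hu : u a = some i
        · have hpos : 0 ≤ 𝓜.expDeviation θ i a (μ i a) h := (Real.exp_pos _).le
          simp only [hu, if_true, ENNReal.ofReal_mul hpos]
          rw [lintegral_const_mul _ (by fun_prop)]
          refine mul_le_of_le_one_right' ?_
          have := 𝓜.isProbabilityMeasure_factor ρ μ u
          have hmp := measurePreserving_eval
            (fun a => (u a).elim (Measure.dirac (0 : ℝ)) fun i => ρ i a (μ i a)) a
          rw [rewardMeasure, hmp.lintegral_comp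
            (f := fun y => ENNReal.ofReal (Real.exp (θ * (y - μ i a) - θ ^ 2 / 4)))
            (by fun_prop)]
          simp only [hu, Option.elim]
          exact lintegral_exp_centred_le hσ (hρ i a _ hμ) θ
        · simp [hu]
      calc _ ≤ ∫⁻ _u, ENNReal.ofReal (𝓜.expDeviation θ i a (μ i a) h)
            ∂((𝓜.recommend (posterior (𝓜.mmts ρ prior t) prior)).prodMkLeft 𝓜.Scores (μ, h)) :=
              lintegral_mono fun u => hreward u
        _ = _ := by simp
    have hm : Measurable fun p : 𝓜.History t × 𝓜.Round =>
        ENNReal.ofReal (𝓜.expDeviation θ i a (μ i a) (𝓜.extend p)) :=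
      (hmeas _).comp 𝓜.measurable_extend
    rw [mmts_succ, extendKernel, Kernel.map_apply _ 𝓜.measurable_extend,
      lintegral_map (hmeas _) 𝓜.measurable_extend,
      Kernel.lintegral_compProd _ _ _ hm]
    exact (lintegral_mono hround).trans ih

end Concentration

/-! ### Joint laws of the scores and the history -/

section JointLaw

variable (ρ : Fin N → 𝓜.Worker → Kernel ℝ ℝ) [∀ i a, IsMarkovKernel (ρ i a)]
variable (prior : Measure 𝓜.Scores) [IsProbabilityMeasure prior]

/-- The joint law of the true scores and the first `t` rounds. -/
noncomputable def jointLaw (t : ℕ) : Measure (𝓜.Scores × 𝓜.History t) :=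
  prior ⊗ₘ 𝓜.mmts ρ prior t

instance (t : ℕ) : IsProbabilityMeasure (𝓜.jointLaw ρ prior t) := by
  unfold jointLaw; infer_instance

/-- The joint law of the true scores, the first `t` rounds and the matching recommended next. -/
noncomputable def recommendLaw (t : ℕ) : Measure ((𝓜.Scores × 𝓜.History t) × 𝓜.Matching) :=
  𝓜.jointLaw ρ prior t ⊗ₘ
    (𝓜.recommend (posterior (𝓜.mmts ρ prior t) prior)).prodMkLeft 𝓜.Scores

instance (t : ℕ) : IsProbabilityMeasure (𝓜.recommendLaw ρ prior t) := by
  unfold recommendLaw; infer_instance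

lemma measurePreserving_fst_recommendLaw (t : ℕ) :
    MeasurePreserving Prod.fst (𝓜.recommendLaw ρ prior t) (𝓜.jointLaw ρ prior t) :=
  ⟨measurable_fst, Measure.fst_compProd _ _⟩

/-- Dropping the rewards of the last round from the first `t + 1` rounds leaves the first `t` rounds
and the matching recommended after them. -/
lemma map_jointLaw_succ (t : ℕ) :
    (𝓜.jointLaw ρ prior (t + 1)).map
      (fun p => ((p.1, fun s : Fin t => p.2 s.castSucc), (p.2 (Fin.last t)).1)) =
    𝓜.recommendLaw ρ prior t := by
  have hf : Measurable fun p : 𝓜.Scores × 𝓜.History (t + 1) =>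
      ((p.1, fun s : Fin t => p.2 s.castSucc), (p.2 (Fin.last t)).1) := by fun_prop
  refine Measure.ext_of_lintegral _ fun g hg => ?_
  have hgf : Measurable fun p : 𝓜.Scores × 𝓜.History (t + 1) =>
      g ((p.1, fun s : Fin t => p.2 s.castSucc), (p.2 (Fin.last t)).1) := hg.comp hf
  have hm : Measurable fun p : 𝓜.Scores × (𝓜.History t × 𝓜.Round) =>
      g ((p.1, p.2.1), p.2.2.1) := by fun_prop
  rw [lintegral_map hg hf, jointLaw, mmts_succ, extendKernel,
    Measure.compProd_map 𝓜.measurable_extend,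
    lintegral_map hgf (measurable_id.prodMap 𝓜.measurable_extend)]
  simp only [Prod.map_fst, Prod.map_snd, id_eq, extend_castSucc, extend_last]
  rw [Measure.lintegral_compProd hm, recommendLaw, Measure.lintegral_compProd hg, jointLaw,
    Measure.lintegral_compProd (hg.lintegral_kernel_prod_right')]
  refine lintegral_congr fun μ => ?_
  rw [Kernel.lintegral_compProd _ _ _ (by fun_prop)]
  refine lintegral_congr fun h => ?_
  rw [roundKernel, Kernel.lintegral_compProd _ _ _ (by fun_prop)]
  simp

/-- Posterior sampling: given the history, the recommended matching has the law of the double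
matching for the true scores. -/
lemma map_recommendLaw (t : ℕ) :
    (𝓜.recommendLaw ρ prior t).map (fun p => (p.1.2, p.2)) =
    (𝓜.jointLaw ρ prior t).map fun p => (p.2, 𝓜.doubleMatching p.1) := by
  have hDM := 𝓜.measurable_doubleMatching
  have hf : Measurable fun p : 𝓜.Scores × 𝓜.History t => (p.2, 𝓜.doubleMatching p.1) := by
    fun_prop
  have hpost : (𝓜.jointLaw ρ prior t).map (fun p => (p.2, 𝓜.doubleMatching p.1)) =
      (𝓜.jointLaw ρ prior t).snd ⊗ₘ 𝓜.recommend (posterior (𝓜.mmts ρ prior t) prior) := by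
    rw [recommend, Measure.compProd_map hDM, jointLaw, Measure.snd_compProd,
      compProd_posterior_eq_map_swap, Measure.map_map (by fun_prop) measurable_swap]
    rfl
  rw [hpost]
  refine Measure.ext_of_lintegral _ fun g hg => ?_
  rw [lintegral_map hg (by fun_prop), recommendLaw, Measure.lintegral_compProd (by fun_prop),
    Measure.lintegral_compProd hg, Measure.snd,
    lintegral_map (hg.lintegral_kernel_prod_right') measurable_snd]
  rfl

lemma ae_jointLaw (hprior : ∀ᵐ μ ∂prior, ∀ i a, μ i a ∈ Set.Icc (0 : ℝ) 1) (t : ℕ) :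
    ∀ᵐ p ∂𝓜.jointLaw ρ prior t, ∀ i a, p.1 i a ∈ Set.Icc (0 : ℝ) 1 := by
  have h : MeasurePreserving Prod.fst (𝓜.jointLaw ρ prior t) prior :=
    ⟨measurable_fst, Measure.fst_compProd _ _⟩
  exact h.quasiMeasurePreserving.ae hprior

lemma ae_recommendLaw (hprior : ∀ᵐ μ ∂prior, ∀ i a, μ i a ∈ Set.Icc (0 : ℝ) 1) (t : ℕ) :
    ∀ᵐ p ∂𝓜.recommendLaw ρ prior t, ∀ i a, p.1.1 i a ∈ Set.Icc (0 : ℝ) 1 :=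
  (𝓜.measurePreserving_fst_recommendLaw ρ prior t).quasiMeasurePreserving.ae
    (𝓜.ae_jointLaw ρ prior hprior t)

lemma ae_recommendLaw_matchingSize_le (t : ℕ) :
    ∀ᵐ p ∂𝓜.recommendLaw ρ prior t, 𝓜.matchingSize p.2 ≤ 𝓜.totalQuota := by
  have h : ∀ᵐ q ∂(𝓜.recommendLaw ρ prior t).map (fun p => (p.1.2, p.2)),
      𝓜.matchingSize q.2 ≤ 𝓜.totalQuota := by
    have hDM := 𝓜.measurable_doubleMatching
    rw [map_recommendLaw, ae_map_iff (by fun_prop)]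
    · exact ae_of_all _ fun p => 𝓜.matchingSize_doubleMatching_le p.1
    · exact measurable_snd (MeasurableSet.of_discrete :
        MeasurableSet {u : 𝓜.Matching | 𝓜.matchingSize u ≤ 𝓜.totalQuota})
  exact ae_of_ae_map (by fun_prop) h

lemma integrable_score {Ω : Type*} [MeasurableSpace Ω] {P : Measure Ω} [IsProbabilityMeasure P]
    {w : Ω → 𝓜.Scores} {u : Ω → 𝓜.Matching} (hw : Measurable w) (hu : Measurable u)
    (h : ∀ᵐ p ∂P, ∀ i a, w p i a ∈ Set.Icc (0 : ℝ) 1) :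
    Integrable (fun p => 𝓜.score (w p) (u p)) P := by
  refine Integrable.of_bound (𝓜.measurable_score.comp (hw.prodMk hu)).aestronglyMeasurable
    (Fintype.card 𝓜.Worker) ?_
  filter_upwards [h] with p hp
  exact 𝓜.abs_score_le hp _

/-! ### Regret of one round -/

/-- The loss of the matching `u` against the double matching for the true scores. -/
noncomputable def gap (μ : 𝓜.Scores) (u : 𝓜.Matching) : ℝ :=
  𝓜.score μ (𝓜.doubleMatching μ) - 𝓜.score μ u

/-- The weights `1 / (n + 1)`, where `n` counts the matches of the pair so far. -/
noncomputable def bonus {t : ℕ} (h : 𝓜.History t) : 𝓜.Scores :=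
  fun i a => 1 / (𝓜.pulls i a h + 1)

lemma bonus_mem {t : ℕ} (h : 𝓜.History t) (i : Fin N) (a : 𝓜.Worker) :
    𝓜.bonus h i a ∈ Set.Icc (0 : ℝ) 1 := by
  have : (0 : ℝ) ≤ 𝓜.pulls i a h := Nat.cast_nonneg _
  refine ⟨by unfold bonus; positivity, ?_⟩
  rw [bonus, div_le_one (by positivity)]
  linarith

lemma measurable_bonus {t : ℕ} : Measurable fun h : 𝓜.History t => 𝓜.bonus h := by
  refine measurable_pi_lambda _ fun i => measurable_pi_lambda _ fun a => ?_
  exact (measurable_of_countable (fun n : ℕ => 1 / ((n : ℝ) + 1))).comp (𝓜.measurable_pulls i a)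

/-- The sum over all pairs of the exponential deviations. -/
noncomputable def totalDeviation (θ : ℝ) {t : ℕ} (p : 𝓜.Scores × 𝓜.History t) : ℝ :=
  ∑ i, ∑ a, 𝓜.expDeviation θ i a (p.1 i a) p.2

lemma measurable_expDeviation_pair (θ : ℝ) (i : Fin N) (a : 𝓜.Worker) (t : ℕ) :
    Measurable fun p : 𝓜.Scores × 𝓜.History t => 𝓜.expDeviation θ i a (p.1 i a) p.2 := by
  have h1 : Measurable fun p : 𝓜.Scores × 𝓜.History t => (p.1 i a, p.2) := by fun_prop
  have h2 := 𝓜.measurable_expDeviation θ i a (t := t)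
  fun_prop

section Noise

variable {σ : ℝ≥0} (hσ : σ ^ 2 ≤ 1 / 2)
  (hprior : ∀ᵐ μ ∂prior, ∀ i a, μ i a ∈ Set.Icc (0 : ℝ) 1)
  (hρ : ∀ i a, ∀ x ∈ Set.Icc (0 : ℝ) 1, HasSubgaussianMGF (fun y => y - x) (σ ^ 2) (ρ i a x))

include hσ hprior hρ

lemma lintegral_expDeviation_jointLaw_le (θ : ℝ) (i : Fin N) (a : 𝓜.Worker) (t : ℕ) :
    ∫⁻ p, ENNReal.ofReal (𝓜.expDeviation θ i a (p.1 i a) p.2) ∂𝓜.jointLaw ρ prior t ≤ 1 := by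
  rw [jointLaw, Measure.lintegral_compProd
    (𝓜.measurable_expDeviation_pair θ i a t).ennreal_ofReal]
  calc _ ≤ ∫⁻ _μ, 1 ∂prior := by
        refine lintegral_mono_ae ?_
        filter_upwards [hprior] with μ hμ
        exact 𝓜.lintegral_expDeviation_le ρ prior hσ hρ θ i a (hμ i a) t
    _ = 1 := by simp

lemma integrable_expDeviation (θ : ℝ) (i : Fin N) (a : 𝓜.Worker) (t : ℕ) :
    Integrable (fun p : 𝓜.Scores × 𝓜.History t => 𝓜.expDeviation θ i a (p.1 i a) p.2)
      (𝓜.jointLaw ρ prior t) := by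
  have h0 : ∀ p : 𝓜.Scores × 𝓜.History t, 0 ≤ 𝓜.expDeviation θ i a (p.1 i a) p.2 := fun p =>
    𝓜.expDeviation_nonneg θ i a _ _
  refine ⟨(𝓜.measurable_expDeviation_pair θ i a t).aestronglyMeasurable, ?_⟩
  rw [hasFiniteIntegral_iff_ofReal (ae_of_all _ h0)]
  exact (𝓜.lintegral_expDeviation_jointLaw_le ρ prior hσ hprior hρ θ i a t).trans_lt
    ENNReal.one_lt_top

lemma integrable_totalDeviation (θ : ℝ) (t : ℕ) :
    Integrable (𝓜.totalDeviation θ) (𝓜.jointLaw ρ prior t) :=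
  integrable_finsetSum _ fun i _ => integrable_finsetSum _ fun a _ =>
    𝓜.integrable_expDeviation ρ prior hσ hprior hρ θ i a t

lemma integral_totalDeviation_le (θ : ℝ) (t : ℕ) :
    ∫ p, 𝓜.totalDeviation θ p ∂𝓜.jointLaw ρ prior t ≤ N * 𝓜.totalWorkers := by
  have h1 : ∀ i a, ∫ p, 𝓜.expDeviation θ i a (p.1 i a) p.2 ∂𝓜.jointLaw ρ prior t ≤ 1 := by
    intro i a
    have h0 : ∀ p : 𝓜.Scores × 𝓜.History t, 0 ≤ 𝓜.expDeviation θ i a (p.1 i a) p.2 := fun p =>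
      𝓜.expDeviation_nonneg θ i a _ _
    rw [integral_eq_lintegral_of_nonneg_ae (ae_of_all _ h0)
      (𝓜.measurable_expDeviation_pair θ i a t).aestronglyMeasurable]
    exact ENNReal.toReal_le_of_le_ofReal zero_le_one
      (by simpa using 𝓜.lintegral_expDeviation_jointLaw_le ρ prior hσ hprior hρ θ i a t)
  have hint := 𝓜.integrable_expDeviation ρ prior hσ hprior hρ θ
  calc ∫ p, 𝓜.totalDeviation θ p ∂𝓜.jointLaw ρ prior t
      = ∑ i, ∑ a, ∫ p, 𝓜.expDeviation θ i a (p.1 i a) p.2 ∂𝓜.jointLaw ρ prior t := by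
        unfold totalDeviation
        rw [integral_finsetSum _ fun i _ => integrable_finsetSum _ fun a _ => hint i a t]
        exact Finset.sum_congr rfl fun i _ => integral_finsetSum _ fun a _ => hint i a t
    _ ≤ ∑ _i : Fin N, ∑ _a : 𝓜.Worker, (1 : ℝ) :=
        Finset.sum_le_sum fun i _ => Finset.sum_le_sum fun a _ => h1 i a
    _ = _ := by rw [← 𝓜.card_worker]; simp

/-- Expected loss of one round. The upper confidence bounds depend on the history only, so by
posterior sampling they have the same expected total over the recommended matching as over the
benchmark. -/
lemma integral_gap_le {α L : ℝ} (hα : 0 < α) (hL : 0 ≤ L) (t : ℕ) :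
    ∫ p, (𝓜.gap p.1.1 p.2 - (1 + 2 * L / α) * 𝓜.score (𝓜.bonus p.1.2) p.2)
      ∂𝓜.recommendLaw ρ prior t ≤
    α / 2 * 𝓜.totalQuota + 2 * (Real.exp (-L) / α * (N * 𝓜.totalWorkers)) := by
  set P := 𝓜.jointLaw ρ prior t with hP
  set ν := 𝓜.recommendLaw ρ prior t
  set ε := Real.exp (-L) / α
  set c := 1 + 2 * L / α
  have hε0 : 0 ≤ ε := by positivity
  have hc0 : 0 ≤ c := by positivity
  have hDM := 𝓜.measurable_doubleMatching
  have hucb := 𝓜.measurable_ucb α L (t := t)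
  have hbonus := 𝓜.measurable_bonus (t := t)
  have hfst : MeasurePreserving Prod.fst ν P := 𝓜.measurePreserving_fst_recommendLaw ρ prior t
  have hdev := fun θ => 𝓜.integrable_totalDeviation ρ prior hσ hprior hρ θ t
  have hdevR : Integrable (fun p => 𝓜.totalDeviation α p.1) ν :=
    hfst.integrable_comp_of_integrable (hdev α)
  have hdev_le := fun θ => 𝓜.integral_totalDeviation_le ρ prior hσ hprior hρ θ t
  have hdevR_le :
      ∫ p : (𝓜.Scores × 𝓜.History t) × 𝓜.Matching, 𝓜.totalDeviation α p.1 ∂ν ≤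
        N * 𝓜.totalWorkers := by
    refine le_of_eq_of_le ?_ (hdev_le α)
    rw [← hP, ← hfst.map_eq, integral_map measurable_fst.aemeasurable]
    rw [hfst.map_eq]
    exact (hdev α).aestronglyMeasurable
  have hexp : ∀ θ (p : 𝓜.Scores × 𝓜.History t) i a,
      0 ≤ 𝓜.expDeviation θ i a (p.1 i a) p.2 := fun θ p i a =>
      𝓜.expDeviation_nonneg θ i a _ p.2
  have haeP := 𝓜.ae_jointLaw ρ prior hprior t
  have haeR := 𝓜.ae_recommendLaw ρ prior hprior t
  have i1 : Integrable (fun p => 𝓜.score p.1 (𝓜.doubleMatching p.1)) P :=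
    𝓜.integrable_score measurable_fst (by fun_prop) haeP
  have i2 : Integrable (fun p => 𝓜.score (𝓜.ucb α L p.2) (𝓜.doubleMatching p.1)) P :=
    𝓜.integrable_score (by fun_prop) (by fun_prop) (ae_of_all _ fun p => 𝓜.ucb_mem α L p.2)
  have i3 : Integrable (fun p => 𝓜.score (𝓜.ucb α L p.1.2) p.2) ν :=
    𝓜.integrable_score (by fun_prop) (by fun_prop) (ae_of_all _ fun p => 𝓜.ucb_mem α L p.1.2)
  have i4 : Integrable (fun p => 𝓜.score p.1.1 p.2) ν :=
    𝓜.integrable_score (by fun_prop) (by fun_prop) haeR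
  have i5 : Integrable (fun p => 𝓜.score (𝓜.bonus p.1.2) p.2) ν :=
    𝓜.integrable_score (by fun_prop) (by fun_prop) (ae_of_all _ fun p => 𝓜.bonus_mem p.1.2)
  have i6 : Integrable (fun p => 𝓜.score p.1.1 (𝓜.doubleMatching p.1.1)) ν :=
    𝓜.integrable_score (by fun_prop) (by fun_prop) haeR
  have hA : ∫ p, 𝓜.score p.1 (𝓜.doubleMatching p.1) ∂P ≤
      ∫ p, 𝓜.score (𝓜.ucb α L p.2) (𝓜.doubleMatching p.1) ∂P + ε * (N * 𝓜.totalWorkers) := by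
    calc _ ≤ ∫ p, (𝓜.score (𝓜.ucb α L p.2) (𝓜.doubleMatching p.1) +
          ε * 𝓜.totalDeviation (-α) p) ∂P := by
          refine integral_mono_ae i1 (i2.add ((hdev _).const_mul ε)) ?_
          filter_upwards [haeP] with p hp
          refine (𝓜.score_mono (fun i a => 𝓜.le_ucb_add (L := L) hα p.2 i a (hp i a)) _).trans ?_
          rw [score_add, score_mul_left]
          gcongr
          exact 𝓜.score_le_sum (hexp (-α) p) _
      _ ≤ _ := by
          rw [integral_add i2 ((hdev _).const_mul ε), integral_const_mul]
          gcongr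
          exact hdev_le _
  have hB : ∫ p, 𝓜.score (𝓜.ucb α L p.2) (𝓜.doubleMatching p.1) ∂P =
      ∫ p, 𝓜.score (𝓜.ucb α L p.1.2) p.2 ∂ν := by
    have hm : Measurable fun q : 𝓜.History t × 𝓜.Matching => 𝓜.score (𝓜.ucb α L q.1) q.2 :=
      𝓜.measurable_score.comp ((hucb.comp measurable_fst).prodMk measurable_snd)
    have e := congrArg (fun η => ∫ q, 𝓜.score (𝓜.ucb α L q.1) q.2 ∂η)
      (𝓜.map_recommendLaw ρ prior t)
    rw [integral_map (by fun_prop) hm.aestronglyMeasurable,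
      integral_map (by fun_prop) hm.aestronglyMeasurable] at e
    exact e.symm
  have hC : ∫ p, 𝓜.score (𝓜.ucb α L p.1.2) p.2 ∂ν ≤
      ∫ p, 𝓜.score p.1.1 p.2 ∂ν + (α / 2 * 𝓜.totalQuota +
        (c * ∫ p, 𝓜.score (𝓜.bonus p.1.2) p.2 ∂ν + ε * (N * 𝓜.totalWorkers))) := by
    have j3 := hdevR.const_mul ε
    have j2 : Integrable (fun p => c * 𝓜.score (𝓜.bonus p.1.2) p.2 +
        ε * 𝓜.totalDeviation α p.1) ν := (i5.const_mul c).add j3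
    have j1 : Integrable (fun p => α / 2 * 𝓜.totalQuota + (c * 𝓜.score (𝓜.bonus p.1.2) p.2 +
        ε * 𝓜.totalDeviation α p.1)) ν := (integrable_const _).add j2
    calc _ ≤ ∫ p, (𝓜.score p.1.1 p.2 + (α / 2 * 𝓜.totalQuota +
          (c * 𝓜.score (𝓜.bonus p.1.2) p.2 + ε * 𝓜.totalDeviation α p.1))) ∂ν := by
          refine integral_mono_ae i3 (i4.add j1) ?_
          filter_upwards [haeR, 𝓜.ae_recommendLaw_matchingSize_le ρ prior t] with p hp hsize
          refine (𝓜.score_mono (fun i a => 𝓜.ucb_le_add hα hL p.1.2 i a (hp i a)) _).trans ?_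
          rw [score_add, score_add, score_add, score_mul_left, score_mul_left, score_const]
          have hsize' : (𝓜.matchingSize p.2 : ℝ) ≤ 𝓜.totalQuota := by exact_mod_cast hsize
          gcongr
          · exact le_rfl
          · exact 𝓜.score_le_sum (hexp α p.1) _
      _ ≤ _ := by
          rw [integral_add i4 j1, integral_add (integrable_const _) j2,
            integral_add (i5.const_mul c) j3]
          simp only [integral_const_mul, integral_const, probReal_univ, smul_eq_mul, one_mul]
          gcongr
  have hD : ∫ p, 𝓜.score p.1.1 (𝓜.doubleMatching p.1.1) ∂ν =
      ∫ p, 𝓜.score p.1 (𝓜.doubleMatching p.1) ∂P := by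
    rw [← hfst.map_eq, integral_map measurable_fst.aemeasurable]
    rw [hfst.map_eq]
    exact i1.aestronglyMeasurable
  have i7 : Integrable (fun p =>
      𝓜.score p.1.1 (𝓜.doubleMatching p.1.1) - 𝓜.score p.1.1 p.2) ν := i6.sub i4
  unfold gap
  rw [integral_sub i7 (i5.const_mul c), integral_sub i6 i4, integral_const_mul, hD]
  linarith

/-! ### Regret over the horizon -/

/-- The sum over all pairs of the harmonic number of the number of matches: the total of the
bonuses that the matched pairs have had in the rounds before. -/
noncomputable def potential {t : ℕ} (h : 𝓜.History t) : ℝ :=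
  ∑ i, ∑ a, (harmonic (𝓜.pulls i a h) : ℝ)

omit hσ hprior hρ in
lemma potential_extend {t : ℕ} (h : 𝓜.History t) (r : 𝓜.Round) :
    𝓜.potential (𝓜.extend (h, r)) = 𝓜.potential h + 𝓜.score (𝓜.bonus h) r.1 := by
  unfold potential
  rw [score_eq_sum_ite, ← Finset.sum_add_distrib]
  refine Finset.sum_congr rfl fun i _ => ?_
  rw [← Finset.sum_add_distrib]
  refine Finset.sum_congr rfl fun a _ => ?_
  rw [pulls_extend]
  split_ifs
  · rw [harmonic_succ]
    simp [bonus]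
  · simp

omit hσ hprior hρ in
lemma potential_le {t : ℕ} (h : 𝓜.History t) :
    𝓜.potential h ≤ N * 𝓜.totalWorkers * (1 + Real.log t) := by
  have h1 : ∀ i a, (harmonic (𝓜.pulls i a h) : ℝ) ≤ 1 + Real.log t := by
    intro i a
    refine (harmonic_le_one_add_log _).trans ?_
    rcases Nat.eq_zero_or_pos (𝓜.pulls i a h) with h0 | h0
    · simpa [h0] using Real.log_natCast_nonneg t
    · gcongr
      exact 𝓜.pulls_le i a h
  calc 𝓜.potential h ≤ ∑ _i : Fin N, ∑ _a : 𝓜.Worker, (1 + Real.log t) :=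
        Finset.sum_le_sum fun i _ => Finset.sum_le_sum fun a _ => h1 i a
    _ = _ := by rw [← 𝓜.card_worker]; simp; ring

omit hσ hρ in
lemma integrable_gap_recommendLaw (t : ℕ) :
    Integrable (fun p => 𝓜.gap p.1.1 p.2) (𝓜.recommendLaw ρ prior t) := by
  have hDM := 𝓜.measurable_doubleMatching
  have hae := 𝓜.ae_recommendLaw ρ prior hprior t
  exact (𝓜.integrable_score (by fun_prop) (by fun_prop) hae).sub
    (𝓜.integrable_score (by fun_prop) (by fun_prop) hae)

/-- The regret of `t` rounds minus a multiple of the potential grows by at most a constant in every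
round. -/
lemma integral_sum_gap_sub_potential_le {α L : ℝ} (hα : 0 < α) (hL : 0 ≤ L) (t : ℕ) :
    Integrable (fun p : 𝓜.Scores × 𝓜.History t =>
      ∑ s, 𝓜.gap p.1 (p.2 s).1 - (1 + 2 * L / α) * 𝓜.potential p.2) (𝓜.jointLaw ρ prior t) ∧
    ∫ p, (∑ s, 𝓜.gap p.1 (p.2 s).1 - (1 + 2 * L / α) * 𝓜.potential p.2) ∂𝓜.jointLaw ρ prior t ≤
      t * (α / 2 * 𝓜.totalQuota + 2 * (Real.exp (-L) / α * (N * 𝓜.totalWorkers))) := by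
  set c := 1 + 2 * L / α with hc
  set b := α / 2 * 𝓜.totalQuota + 2 * (Real.exp (-L) / α * (N * 𝓜.totalWorkers)) with hb
  induction t with
  | zero => simp [potential, pulls]
  | succ t ih =>
    have hbonus := 𝓜.measurable_bonus (t := t)
    have hfst := 𝓜.measurePreserving_fst_recommendLaw ρ prior t
    have iF := hfst.integrable_comp_of_integrable ih.1
    have ib : Integrable (fun p => 𝓜.score (𝓜.bonus p.1.2) p.2) (𝓜.recommendLaw ρ prior t) :=
      𝓜.integrable_score (by fun_prop) (by fun_prop) (ae_of_all _ fun p => 𝓜.bonus_mem p.1.2)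
    have ig : Integrable (fun p => 𝓜.gap p.1.1 p.2 - c * 𝓜.score (𝓜.bonus p.1.2) p.2)
        (𝓜.recommendLaw ρ prior t) :=
      (𝓜.integrable_gap_recommendLaw ρ prior hprior t).sub (ib.const_mul c)
    have hmp : MeasurePreserving (fun p : 𝓜.Scores × 𝓜.History (t + 1) =>
        ((p.1, fun s : Fin t => p.2 s.castSucc), (p.2 (Fin.last t)).1))
        (𝓜.jointLaw ρ prior (t + 1)) (𝓜.recommendLaw ρ prior t) :=
      ⟨by fun_prop, 𝓜.map_jointLaw_succ ρ prior t⟩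
    have isum := iF.add ig
    have e : (fun p : 𝓜.Scores × 𝓜.History (t + 1) =>
        ∑ s, 𝓜.gap p.1 (p.2 s).1 - c * 𝓜.potential p.2) =
      (fun q : (𝓜.Scores × 𝓜.History t) × 𝓜.Matching =>
        (∑ s, 𝓜.gap q.1.1 (q.1.2 s).1 - c * 𝓜.potential q.1.2) +
          (𝓜.gap q.1.1 q.2 - c * 𝓜.score (𝓜.bonus q.1.2) q.2)) ∘
      fun p => ((p.1, fun s : Fin t => p.2 s.castSucc), (p.2 (Fin.last t)).1) := by
      funext p
      have hext : p.2 = 𝓜.extend (fun s : Fin t => p.2 s.castSucc, p.2 (Fin.last t)) :=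
        (Fin.snoc_init_self p.2).symm
      have hpot := 𝓜.potential_extend (fun s : Fin t => p.2 s.castSucc) (p.2 (Fin.last t))
      rw [← hext] at hpot
      simp only [Function.comp_apply, Fin.sum_univ_castSucc, hpot]
      ring
    rw [e]
    refine ⟨hmp.integrable_comp_of_integrable isum, ?_⟩
    have e1 : ∫ p, ((fun q : (𝓜.Scores × 𝓜.History t) × 𝓜.Matching =>
        (∑ s, 𝓜.gap q.1.1 (q.1.2 s).1 - c * 𝓜.potential q.1.2) +
          (𝓜.gap q.1.1 q.2 - c * 𝓜.score (𝓜.bonus q.1.2) q.2)) ∘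
      fun p => ((p.1, fun s : Fin t => p.2 s.castSucc), (p.2 (Fin.last t)).1)) p
        ∂𝓜.jointLaw ρ prior (t + 1) =
      ∫ q, ((∑ s, 𝓜.gap q.1.1 (q.1.2 s).1 - c * 𝓜.potential q.1.2) +
          (𝓜.gap q.1.1 q.2 - c * 𝓜.score (𝓜.bonus q.1.2) q.2)) ∂𝓜.recommendLaw ρ prior t := by
      rw [← hmp.map_eq, integral_map hmp.measurable.aemeasurable]
      · rfl
      · rw [hmp.map_eq]
        exact isum.aestronglyMeasurable
    have e2 : ∫ q, (∑ s, 𝓜.gap q.1.1 (q.1.2 s).1 - c * 𝓜.potential q.1.2)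
        ∂𝓜.recommendLaw ρ prior t =
      ∫ p, (∑ s, 𝓜.gap p.1 (p.2 s).1 - c * 𝓜.potential p.2) ∂𝓜.jointLaw ρ prior t := by
      rw [← hfst.map_eq, integral_map hfst.measurable.aemeasurable]
      rw [hfst.map_eq]
      exact ih.1.aestronglyMeasurable
    have e3 := integral_add iF ig
    simp only [Function.comp_apply] at e3
    rw [e1, e3, e2]
    have hround := 𝓜.integral_gap_le ρ prior hσ hprior hρ hα hL t
    have := ih.2
    push_cast
    linarith

end Noise

end JointLaw

section Regret

variable (ρ : Fin N → 𝓜.Worker → Kernel ℝ ℝ) [∀ i a, IsMarkovKernel (ρ i a)]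
variable (prior : Measure 𝓜.Scores) [IsProbabilityMeasure prior]

lemma sum_firmRegret (T : ℕ) (μ : 𝓜.Scores) :
    ∑ i, 𝓜.firmRegret ρ prior i T μ =
      ∫ h, ∑ t : Fin T, 𝓜.gap μ (h t).1 ∂𝓜.mmts ρ prior T μ := by
  have : Finite 𝓜.Matching := inferInstanceAs (Finite (𝓜.Worker → Option (Fin N)))
  have hint : ∀ i m, Integrable (fun h : 𝓜.History T =>
      ∑ t : Fin T, (𝓜.typeScore μ i m (𝓜.doubleMatching μ) - 𝓜.typeScore μ i m (h t).1))
      (𝓜.mmts ρ prior T μ) := by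
    intro i m
    refine integrable_finsetSum _ fun t _ => (integrable_const _).sub ?_
    have hm : Measurable fun h : 𝓜.History T => (h t).1 := by fun_prop
    have := Measure.isProbabilityMeasure_map (μ := 𝓜.mmts ρ prior T μ) hm.aemeasurable
    have hf : Integrable (𝓜.typeScore μ i m) ((𝓜.mmts ρ prior T μ).map fun h => (h t).1) :=
      Integrable.of_finite
    exact hf.comp_measurable hm
  unfold firmRegret firmTypeRegret
  simp_rw [← integral_finsetSum _ fun m _ => hint _ m]
  rw [← integral_finsetSum _ fun i _ => integrable_finsetSum _ fun m _ => hint i m]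
  refine integral_congr_ae (ae_of_all _ fun h => ?_)
  dsimp only
  simp_rw [Finset.sum_comm (t := (Finset.univ : Finset (Fin T)))]
  refine Finset.sum_congr rfl fun t _ => ?_
  simp only [Finset.sum_sub_distrib, sum_typeScore, gap]

lemma integrable_sum_gap (hprior : ∀ᵐ μ ∂prior, ∀ i a, μ i a ∈ Set.Icc (0 : ℝ) 1) (T : ℕ) :
    Integrable (fun p : 𝓜.Scores × 𝓜.History T => ∑ t, 𝓜.gap p.1 (p.2 t).1)
      (𝓜.jointLaw ρ prior T) := by
  have hDM := 𝓜.measurable_doubleMatching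
  have hae := 𝓜.ae_jointLaw ρ prior hprior T
  exact integrable_finsetSum _ fun t _ =>
    (𝓜.integrable_score (by fun_prop) (by fun_prop) hae).sub
      (𝓜.integrable_score (by fun_prop) (by fun_prop) hae)

lemma integrable_sum_firmRegret (hprior : ∀ᵐ μ ∂prior, ∀ i a, μ i a ∈ Set.Icc (0 : ℝ) 1) (T : ℕ) :
    Integrable (fun μ => ∑ i, 𝓜.firmRegret ρ prior i T μ) prior := by
  simp only [sum_firmRegret]
  exact Integrable.integral_compProd (κ := Kernel.const Unit prior)
    (η := Kernel.prodMkLeft Unit (𝓜.mmts ρ prior T)) (a := ())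
    (𝓜.integrable_sum_gap ρ prior hprior T)

lemma socialWelfareGap_eq (hprior : ∀ᵐ μ ∂prior, ∀ i a, μ i a ∈ Set.Icc (0 : ℝ) 1) (T : ℕ) :
    𝓜.socialWelfareGap ρ prior T =
      ∫ p, ∑ t : Fin T, 𝓜.gap p.1 (p.2 t).1 ∂𝓜.jointLaw ρ prior T := by
  unfold socialWelfareGap
  simp only [sum_firmRegret]
  exact (Measure.integral_compProd (𝓜.integrable_sum_gap ρ prior hprior T)).symm

/-- The trivial bound: a round loses at most the size of the benchmark matching. -/
lemma socialWelfareGap_le_mul (hprior : ∀ᵐ μ ∂prior, ∀ i a, μ i a ∈ Set.Icc (0 : ℝ) 1) (T : ℕ)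
    {c : ℕ} (hc : ∀ x, 𝓜.matchingSize (𝓜.doubleMatching x) ≤ c) :
    𝓜.socialWelfareGap ρ prior T ≤ T * c := by
  rw [socialWelfareGap_eq _ _ _ hprior]
  calc _ ≤ ∫ _p, (T * c : ℝ) ∂𝓜.jointLaw ρ prior T := by
        refine integral_mono_ae (𝓜.integrable_sum_gap ρ prior hprior T) (integrable_const _) ?_
        filter_upwards [𝓜.ae_jointLaw ρ prior hprior T] with p hp
        have h : ∀ t : Fin T, 𝓜.gap p.1 (p.2 t).1 ≤ c := by
          intro t
          have h1 := 𝓜.score_le_matchingSize (fun i a => (hp i a).2) (𝓜.doubleMatching p.1)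
          have h2 := 𝓜.score_nonneg (fun i a => (hp i a).1) (p.2 t).1
          have h3 : (𝓜.matchingSize (𝓜.doubleMatching p.1) : ℝ) ≤ c := by exact_mod_cast hc p.1
          unfold gap
          linarith
        simpa using Finset.sum_le_sum fun t (_ : t ∈ Finset.univ) => h t
    _ = _ := by simp

/-- The regret bound for an arbitrary tilt `α` and level `L`. -/
lemma socialWelfareGap_le {σ : ℝ≥0} (hσ : σ ^ 2 ≤ 1 / 2)
    (hprior : ∀ᵐ μ ∂prior, ∀ i a, μ i a ∈ Set.Icc (0 : ℝ) 1)
    (hρ : ∀ i a, ∀ x ∈ Set.Icc (0 : ℝ) 1, HasSubgaussianMGF (fun y => y - x) (σ ^ 2) (ρ i a x))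
    {α L : ℝ} (hα : 0 < α) (hL : 0 ≤ L) (T : ℕ) :
    𝓜.socialWelfareGap ρ prior T ≤
      T * (α / 2 * 𝓜.totalQuota + 2 * (Real.exp (-L) / α * (N * 𝓜.totalWorkers))) +
        (1 + 2 * L / α) * (N * 𝓜.totalWorkers * (1 + Real.log T)) := by
  rw [socialWelfareGap_eq _ _ _ hprior]
  obtain ⟨h1, h2⟩ := 𝓜.integral_sum_gap_sub_potential_le ρ prior hσ hprior hρ hα hL T
  set c := 1 + 2 * L / α
  set C := c * (N * 𝓜.totalWorkers * (1 + Real.log T))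
  have hc0 : 0 ≤ c := by positivity
  calc ∫ p, ∑ t : Fin T, 𝓜.gap p.1 (p.2 t).1 ∂𝓜.jointLaw ρ prior T
      ≤ ∫ p, ((∑ t, 𝓜.gap p.1 (p.2 t).1 - c * 𝓜.potential p.2) + C) ∂𝓜.jointLaw ρ prior T := by
        refine integral_mono (𝓜.integrable_sum_gap ρ prior hprior T)
          (h1.add (integrable_const C)) fun p => ?_
        have := mul_le_mul_of_nonneg_left (𝓜.potential_le p.2) hc0
        dsimp only
        linarith
    _ = ∫ p, (∑ t, 𝓜.gap p.1 (p.2 t).1 - c * 𝓜.potential p.2) ∂𝓜.jointLaw ρ prior T + C := by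
        rw [integral_add h1 (integrable_const C)]
        simp
    _ ≤ _ := by linarith

end Regret

/-! ### Choice of the parameters -/

/-- The regret bound with level `ℓ = log (q s²)` and tilt `α = 2 ℓ k / s`, where `k` and `s` are the
square roots of `K_max` and of the horizon. -/
lemma tuned_bound_le {B q k s ℓ l : ℝ} (hk : 1 ≤ k) (hℓ : 1 ≤ ℓ) (hs : 8 * ℓ * k ≤ s)
    (hq : 1 ≤ q) (hB0 : 0 ≤ B) (hB : B ≤ q * k ^ 2) (hl0 : 0 ≤ l) (hl : l ≤ ℓ) :
    s ^ 2 * (2 * ℓ * k / s / 2 * q + 2 * ((q * s ^ 2)⁻¹ / (2 * ℓ * k / s) * B)) +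
      (1 + 2 * ℓ / (2 * ℓ * k / s)) * (B * (1 + l)) ≤ 8 * q * ℓ * (k * s) := by
  have hks : k ≤ s := by nlinarith
  have hs0 : 0 < s := by linarith
  have hk0 : 0 < k := by linarith
  have hℓ0 : 0 < ℓ := by linarith
  have hq0 : 0 < q := by linarith
  have hqks : 0 ≤ q * (k * s) := by positivity
  have h1 : s ^ 2 * (2 * ℓ * k / s / 2 * q) = ℓ * (q * (k * s)) := by field_simp
  have h2 : s ^ 2 * (2 * ((q * s ^ 2)⁻¹ / (2 * ℓ * k / s) * B)) ≤ ℓ * (q * (k * s)) := by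
    have e : s ^ 2 * (2 * ((q * s ^ 2)⁻¹ / (2 * ℓ * k / s) * B)) = B * s / (q * ℓ * k) := by
      field_simp
    rw [e, div_le_iff₀ (by positivity)]
    have hqℓ : 1 ≤ q * ℓ ^ 2 := by nlinarith [one_le_pow₀ hℓ (n := 2)]
    calc B * s ≤ q * k ^ 2 * s := by gcongr
      _ ≤ q * k ^ 2 * s * (q * ℓ ^ 2) := le_mul_of_one_le_right (by positivity) hqℓ
      _ = _ := by ring
  have h3 : (1 + 2 * ℓ / (2 * ℓ * k / s)) * (B * (1 + l)) ≤ 4 * (ℓ * (q * (k * s))) := by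
    have e : 1 + 2 * ℓ / (2 * ℓ * k / s) = (k + s) / k := by field_simp
    rw [e]
    calc (k + s) / k * (B * (1 + l)) ≤ (s + s) / k * (q * k ^ 2 * (ℓ + ℓ)) := by gcongr
      _ = _ := by field_simp; ring
  nlinarith [mul_nonneg hℓ0.le hqks]

end Market
end CMCPR

theorem theorem2 {N M : ℕ} (𝓜 : CMCPR.Market N M)
    (hQ : ∀ i, M ≤ 𝓜.Q i)
    (prior : Measure 𝓜.Scores) [IsProbabilityMeasure prior]
    (hprior : ∀ᵐ μ ∂prior, ∀ i a, μ i a ∈ Set.Icc (0 : ℝ) 1)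
    (ρ : Fin N → 𝓜.Worker → Kernel ℝ ℝ) [∀ i a, IsMarkovKernel (ρ i a)]
    (σ : ℝ≥0) (hσ : σ ^ 2 ≤ 1 / 2)
    (hρ : ∀ i a, ∀ x ∈ Set.Icc (0 : ℝ) 1,
      HasSubgaussianMGF (fun y => y - x) (σ ^ 2) (ρ i a x))
    (T : ℕ) :
    Integrable (fun μ => ∑ i, 𝓜.firmRegret ρ prior i T μ) prior ∧
    𝓜.socialWelfareGap ρ prior T ≤
      8 * 𝓜.totalQuota * Real.log (𝓜.totalQuota * T) * √(𝓜.maxWorkers * T)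
        + N * 𝓜.totalWorkers / 𝓜.totalQuota := by
  refine ⟨𝓜.integrable_sum_firmRegret ρ prior hprior T, ?_⟩
  have hℓ0 : 0 ≤ Real.log (𝓜.totalQuota * T) := by
    exact_mod_cast Real.log_natCast_nonneg (𝓜.totalQuota * T)
  have hrest : (0 : ℝ) ≤ N * 𝓜.totalWorkers / 𝓜.totalQuota := by positivity
  have hmain : 0 ≤ 8 * 𝓜.totalQuota * Real.log (𝓜.totalQuota * T) * √(𝓜.maxWorkers * T) := by
    positivity
  have htriv := 𝓜.socialWelfareGap_le_mul ρ prior hprior T 𝓜.matchingSize_doubleMatching_le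
  rcases Nat.eq_zero_or_pos T with hT | hT
  · have hT0 : (T : ℝ) = 0 := by exact_mod_cast hT
    have : (T : ℝ) * 𝓜.totalQuota = 0 := by rw [hT0, zero_mul]
    linarith
  rcases Nat.eq_zero_or_pos 𝓜.totalQuota with hq | hq
  · rw [hq, Nat.cast_zero, mul_zero] at htriv
    linarith
  rcases Nat.eq_zero_or_pos 𝓜.totalWorkers with hK | hK
  · have := 𝓜.socialWelfareGap_le_mul ρ prior hprior T (c := 0) fun x =>
      (Finset.card_le_univ _).trans (by rw [𝓜.card_worker, hK])
    rw [Nat.cast_zero, mul_zero] at this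
    linarith
  have hN : 0 < N := by
    rcases Nat.eq_zero_or_pos N with rfl | h
    · simp [CMCPR.Market.totalQuota] at hq
    · exact h
  have hmul := 𝓜.mul_totalWorkers_le hQ
  have hmax : 1 ≤ 𝓜.maxWorkers :=
    Nat.pos_of_mul_pos_left ((Nat.mul_pos hN hK).trans_le hmul)
  have hq' : (1 : ℝ) ≤ 𝓜.totalQuota := by exact_mod_cast hq
  have hT' : (1 : ℝ) ≤ T := by exact_mod_cast hT
  rcases Nat.lt_or_ge (𝓜.totalQuota * T) 2 with h2 | h2
  · -- One position and one round: the logarithm vanishes, and the second summand is `N * K ≥ 1`.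
    have hq1 : 𝓜.totalQuota = 1 := by nlinarith
    have hT1 : T = 1 := by nlinarith
    have hNK : (1 : ℝ) ≤ N * 𝓜.totalWorkers := by exact_mod_cast Nat.mul_pos hN hK
    rw [hq1, hT1] at htriv
    rw [hq1, hT1] at hmain ⊢
    norm_num at htriv ⊢
    linarith
  set ℓ := Real.log (𝓜.totalQuota * T) with hℓ
  set k := √(𝓜.maxWorkers : ℝ)
  set s := √(T : ℝ)
  have hks : √(𝓜.maxWorkers * T : ℝ) = k * s := Real.sqrt_mul (Nat.cast_nonneg _) _
  have hk2 : k ^ 2 = 𝓜.maxWorkers := Real.sq_sqrt (Nat.cast_nonneg _)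
  have hs2 : s ^ 2 = T := Real.sq_sqrt (Nat.cast_nonneg _)
  have hk1 : 1 ≤ k := Real.one_le_sqrt.2 (by exact_mod_cast hmax)
  have hs1 : 1 ≤ s := Real.one_le_sqrt.2 hT'
  rw [hks]
  rcases le_or_gt s (8 * ℓ * k) with hsmall | hlarge
  · -- For a short horizon the trivial bound suffices.
    have : T * (𝓜.totalQuota : ℝ) ≤ 8 * 𝓜.totalQuota * ℓ * (k * s) := by
      calc T * (𝓜.totalQuota : ℝ) = 𝓜.totalQuota * s * s := by rw [← hs2]; ring
        _ ≤ 𝓜.totalQuota * s * (8 * ℓ * k) := by gcongr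
        _ = _ := by ring
    linarith
  · have hℓ2 : 0.69 ≤ ℓ := by
      have h : Real.log 2 ≤ ℓ := Real.log_le_log two_pos (by exact_mod_cast h2)
      linarith [Real.log_two_gt_d9]
    have hT3 : (3 : ℝ) ≤ T := by
      have : 5 ≤ s := by nlinarith
      nlinarith
    have hlogT : Real.log T ≤ ℓ :=
      Real.log_le_log (by linarith) (le_mul_of_one_le_left (by linarith) hq')
    have hℓ1 : 1 ≤ ℓ := by
      refine le_trans ?_ hlogT
      rw [Real.le_log_iff_exp_le (by linarith)]
      linarith [Real.exp_one_lt_d9]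
    have hexp : Real.exp (-ℓ) = ((𝓜.totalQuota : ℝ) * s ^ 2)⁻¹ := by
      rw [Real.exp_neg, hs2, hℓ, Real.exp_log (by positivity)]
    have hB : (N * 𝓜.totalWorkers : ℝ) ≤ 𝓜.totalQuota * k ^ 2 := by
      rw [hk2]
      exact_mod_cast hmul
    have hbound := 𝓜.socialWelfareGap_le ρ prior hσ hprior hρ
      (α := 2 * ℓ * k / s) (L := ℓ) (by positivity) hℓ0 T
    have htuned := CMCPR.Market.tuned_bound_le hk1 hℓ1 hlarge.le hq' (by positivity) hB
      (Real.log_natCast_nonneg T) hlogT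
    rw [hexp, ← hs2] at hbound
    rw [hs2] at hbound htuned
    linarith
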